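/- For $n\times n$ complex matrices $A$ with no eigenvalue in $\{0,-1,-2,\dots\}$ let $\Gamma(A)$ denote the matrix gamma function, i.e. the primary matrix function of $\Gamma$ at $A$: $\Gamma(A)=r(A)$, where $r$ is the unique polynomial of degree less than the degree of the minimal polynomial $\psi$ of $A$ such that $r^{(j)}(\mu)=\Gamma^{(j)}(\mu)$ for every eigenvalue $\mu$ of $A$ and every $0\le j<m_\mu$, $m_\mu$ being the multiplicity of $\mu$ as a zero of $\psi$. For $p\in\mathbb{Z}_{>0}\cup\{\infty\}$ let $\|\cdot\|_p$ be the matrix norm induced by the vector $p$-norm, and for $\alpha>0$ put $$\omega(\alpha):=\frac{2\alpha+1}{\alpha^2(\alpha+1)^2}+\frac{\cosh(1)-1}{(\alpha+2)^2}.$$ Let $p\in\mathbb{Z}_{>0}\cup\{\infty\}$, $\hat\lambda\in\mathbb{C}$, $Q\in\mathbb{C}^{n\times n}$, and let $R\in\mathbb{R}^{n\times n}$ be entrywise nonnegative. Suppose that $|Q_{ij}|\le R_{ij}$ for all $i,j$ and that $\operatorname{Re}(\hat\lambda)-\|R\|_p>0$, and define $$\delta_p:=\|R\|_p\Bigl(\Gamma'\bigl(\operatorname{Re}(\hat\lambda)+\|R\|_p\bigr)+\omega\bigl(\operatorname{Re}(\hat\lambda)+\|R\|_p\bigr)+\omega\bigl(\operatorname{Re}(\hat\lambda)-\|R\|_p\bigr)\Bigr).$$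 Then $$\bigl\|\Gamma(\hat\lambda I+Q)-\Gamma(\hat\lambda I)\bigr\|_p\le\delta_p,$$ and the inequality is strict whenever $R\neq 0$. -/

import Mathlib

open scoped ENNReal

/-- `r` is the Hermite interpolation polynomial of `f` on the spectrum of the square matrix `A`:
its degree is smaller than that of the minimal polynomial `ψ` of `A`, and at every `μ` its
derivatives of order `j < (multiplicity of μ as a zero of ψ)` agree with those of `f`.
(The condition is empty when `μ` is not an eigenvalue of `A`.) -/
def IsHermiteInterpolant {n : ℕ} (f : ℂ → ℂ) (A : Matrix (Fin n) (Fin n) ℂ)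
    (r : Polynomial ℂ) : Prop :=
  r.degree < (minpoly ℂ A).degree ∧
    ∀ μ : ℂ, ∀ j < (minpoly ℂ A).rootMultiplicity μ,
      (Polynomial.derivative^[j] r).eval μ = iteratedDeriv j f μ

theorem eq_zero_of_hermite_zero {m r : Polynomial ℂ} (hd : r.degree < m.degree)
    (h : ∀ μ : ℂ, ∀ j < m.rootMultiplicity μ, (Polynomial.derivative^[j] r).eval μ = 0) :
    r = 0 := by
  by_contra hr
  have hle : m.roots ≤ r.roots := by
    rw [Multiset.le_iff_count]
    intro μ
    rw [Polynomial.count_roots, Polynomial.count_roots]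
    rcases Nat.eq_zero_or_pos (m.rootMultiplicity μ) with h0 | h0
    · omega
    · have := Polynomial.lt_rootMultiplicity_of_isRoot_iterate_derivative
        (n := m.rootMultiplicity μ - 1) hr (fun j hj => h μ j (by omega))
      omega
  have h1 : m.natDegree ≤ r.natDegree := by
    calc m.natDegree = Multiset.card m.roots :=
          (IsAlgClosed.splits m).natDegree_eq_card_roots
      _ ≤ Multiset.card r.roots := Multiset.card_le_card hle
      _ ≤ r.natDegree := Polynomial.card_roots' r
  exact absurd (Polynomial.natDegree_lt_natDegree hr hd) (by omega)

/-- The Hermite interpolation polynomial exists and is unique, so that the primary matrix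
function below is well defined. -/
theorem existsUnique_isHermiteInterpolant {n : ℕ} (f : ℂ → ℂ) (A : Matrix (Fin n) (Fin n) ℂ) :
    ∃! r : Polynomial ℂ, IsHermiteInterpolant f A r := by
  have hm : minpoly ℂ A ≠ 0 := minpoly.ne_zero (Matrix.isIntegral A)
  unfold IsHermiteInterpolant
  generalize minpoly ℂ A = m at hm
  refine existsUnique_of_exists_of_unique ?_ ?_
  · let ι := Σ μ : m.roots.toFinset, Fin (m.rootMultiplicity (μ : ℂ))
    let L : Polynomial.degreeLT ℂ m.natDegree →ₗ[ℂ] (ι → ℂ) :=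
      LinearMap.pi fun i => (Polynomial.leval (i.1 : ℂ)).comp
        (((Polynomial.derivative (R := ℂ)) ^ (i.2 : ℕ)).comp (Submodule.subtype _))
    have hL : ∀ (r : Polynomial.degreeLT ℂ m.natDegree) (i : ι),
        L r i = (Polynomial.derivative^[(i.2 : ℕ)] (r : Polynomial ℂ)).eval (i.1 : ℂ) := by
      intro r i
      simp [L, Module.End.pow_apply, Polynomial.leval]
    have key : ∀ (r : Polynomial.degreeLT ℂ m.natDegree) (g : ℂ → ℕ → ℂ),
        (∀ i : ι, L r i = g i.1 i.2) → ∀ μ : ℂ, ∀ j < m.rootMultiplicity μ,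
          (Polynomial.derivative^[j] (r : Polynomial ℂ)).eval μ = g μ j := by
      intro r g h μ j hj
      have hμ : μ ∈ m.roots.toFinset := by
        rw [Multiset.mem_toFinset, ← Multiset.count_pos, Polynomial.count_roots]
        omega
      have := h ⟨⟨μ, hμ⟩, ⟨j, hj⟩⟩
      rwa [hL] at this
    have hdeg : ∀ r : Polynomial.degreeLT ℂ m.natDegree,
        (r : Polynomial ℂ).degree < m.degree := by
      intro r
      rw [Polynomial.degree_eq_natDegree hm]
      exact Polynomial.mem_degreeLT.1 r.2
    have hinj : Function.Injective L := by
      rw [injective_iff_map_eq_zero]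
      intro r hr
      apply Subtype.ext
      exact eq_zero_of_hermite_zero (hdeg r)
        (key r (fun _ _ => 0) (fun i => by rw [hr]; rfl))
    have hfr : Module.finrank ℂ (Polynomial.degreeLT ℂ m.natDegree)
        = Module.finrank ℂ (ι → ℂ) := by
      rw [(Polynomial.degreeLTEquiv ℂ m.natDegree).finrank_eq, Module.finrank_fin_fun,
        Module.finrank_fintype_fun_eq_card, Fintype.card_sigma]
      simp only [Fintype.card_fin]
      rw [Finset.sum_coe_sort m.roots.toFinset (fun μ => m.rootMultiplicity μ),
        (IsAlgClosed.splits m).natDegree_eq_card_roots, ← Multiset.toFinset_sum_count_eq]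
      simp only [Polynomial.count_roots]
    have : FiniteDimensional ℂ (Polynomial.degreeLT ℂ m.natDegree) :=
      Module.Finite.equiv (Polynomial.degreeLTEquiv ℂ m.natDegree).symm
    obtain ⟨r, hr⟩ := (LinearMap.injective_iff_surjective_of_finrank_eq_finrank hfr).1 hinj
      (fun i => iteratedDeriv i.2 f i.1)
    exact ⟨r, hdeg r, key r (fun μ j => iteratedDeriv j f μ) (fun i => by rw [hr])⟩
  · rintro r s ⟨hr, hr'⟩ ⟨hs, hs'⟩
    rw [← sub_eq_zero]
    refine eq_zero_of_hermite_zero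
      (lt_of_le_of_lt (Polynomial.degree_sub_le r s) (max_lt hr hs)) ?_
    intro μ j hj
    rw [Polynomial.iterate_derivative_sub, Polynomial.eval_sub, hr' μ j hj, hs' μ j hj, sub_self]

/-- The primary matrix function `f(A) = r(A)`, with `r` the Hermite interpolation polynomial of `f`
on the spectrum of `A`. Meaningful when `f` is analytic at every eigenvalue of `A`. -/
noncomputable def primaryMatrixFunction {n : ℕ} (f : ℂ → ℂ) (A : Matrix (Fin n) (Fin n) ℂ) :
    Matrix (Fin n) (Fin n) ℂ :=
  Polynomial.aeval A (existsUnique_isHermiteInterpolant f A).choose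

/-- The matrix gamma function, meaningful for matrices without eigenvalues in `{0, -1, -2, …}`. -/
noncomputable def matrixGamma {n : ℕ} (A : Matrix (Fin n) (Fin n) ℂ) : Matrix (Fin n) (Fin n) ℂ :=
  primaryMatrixFunction Complex.Gamma A

/-- The matrix norm induced by the vector `p`-norm on `ℂⁿ`. -/
noncomputable def matrixPNorm {n : ℕ} (p : ℝ≥0∞) [Fact (1 ≤ p)] (A : Matrix (Fin n) (Fin n) ℂ) :
    ℝ :=
  ‖LinearMap.toContinuousLinearMap (Matrix.toLpLin p p A)‖

/-- The explicit bound `ω(α)`, for `α > 0`. -/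
noncomputable def omegaBound (α : ℝ) : ℝ :=
  (2 * α + 1) / (α ^ 2 * (α + 1) ^ 2) + (Real.cosh 1 - 1) / (α + 2) ^ 2

/-- `δ = ρ (Γ'(x + ρ) + ω(x + ρ) + ω(x - ρ))`, where `x = Re λ` and `ρ = ‖R‖_p`. -/
noncomputable def deltaBound (x ρ : ℝ) : ℝ :=
  ρ * (deriv Real.Gamma (x + ρ) + omegaBound (x + ρ) + omegaBound (x - ρ))

/-! When the spectrum of `A` lies in the right half plane, Euler's integral holds: Γ(A) = ∫ e^{-t}
t^{A-1} dt over t > 0. Indeed a primary matrix function depends linearly on the Hermite data of the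
function, and differentiating the scalar integral for Γ shows that these data are the integrals of
the data of z ↦ t^{z-1} e^{-t} (`matrixGamma_eq_integral`).

Write x = Re λ and ρ = ‖R‖_p, so that ‖Q‖_p ≤ ρ. The integrand of the difference has norm at most
e^{-t} t^{x-1} (e^{ρ|log t|} - 1) ≤ ρ e^{-t} t^{x-1} |log t| e^{ρ|log t|}. For t > 1 the last
expression is ρ times the integrand of Γ'(x+ρ). On (0, 1] that integrand is nonpositive and is
compensated by a weight at x+ρ, while the bound itself needs a weight at x-ρ. Since e^{-t} ≤ 1 - t +
t²/2, such a weight integrates to 1/α² - 1/(α+1)² + 1/(2(α+2)²), which is less than ω(α) because 1/2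
< cosh 1 - 1. This gap gives strictness. -/

/-! ### Matrix functions through Hermite data -/

/-- The pairs of a root of the minimal polynomial and an order of derivation below its
multiplicity. -/
abbrev JetIndex {n : ℕ} (A : Matrix (Fin n) (Fin n) ℂ) : Type :=
  Σ μ : (minpoly ℂ A).roots.toFinset, Fin ((minpoly ℂ A).rootMultiplicity (μ : ℂ))

/-- A polynomial whose Hermite data on the spectrum of `A` vanish annihilates `A`. -/
theorem aeval_eq_zero_of_hermite_zero {n : ℕ} (A : Matrix (Fin n) (Fin n) ℂ) (P : Polynomial ℂ)
    (h : ∀ μ : ℂ, ∀ j < (minpoly ℂ A).rootMultiplicity μ,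
      (Polynomial.derivative^[j] P).eval μ = 0) :
    Polynomial.aeval A P = 0 := by
  have hA : IsIntegral ℂ A := Matrix.isIntegral A
  have hm := minpoly.monic hA
  have h0 : P %ₘ minpoly ℂ A = 0 := by
    refine eq_zero_of_hermite_zero (Polynomial.degree_modByMonic_lt P hm) fun μ j hj => ?_
    -- The zero product is split off because `rootMultiplicity` of the zero polynomial is 0.
    have hle : (minpoly ℂ A).rootMultiplicity μ ≤
        (minpoly ℂ A * (P /ₘ minpoly ℂ A)).rootMultiplicity μ ∨
        minpoly ℂ A * (P /ₘ minpoly ℂ A) = 0 := by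
      by_cases hz : minpoly ℂ A * (P /ₘ minpoly ℂ A) = 0
      · exact Or.inr hz
      · exact Or.inl (Polynomial.rootMultiplicity_le_rootMultiplicity_of_dvd hz
          (dvd_mul_right _ _) μ)
    rw [Polynomial.modByMonic_eq_sub_mul_div, Polynomial.iterate_derivative_sub,
      Polynomial.eval_sub, h μ j hj, zero_sub, neg_eq_zero]
    rcases hle with hle | hz
    · exact Polynomial.isRoot_iterate_derivative_of_lt_rootMultiplicity (hj.trans_le hle)
    · simp [hz]
  exact (Polynomial.aeval_eq_zero_of_dvd_aeval_eq_zero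
    ((Polynomial.modByMonic_eq_zero_iff_dvd hm).1 h0) (minpoly.aeval ℂ A))

/-- Evaluation of polynomials at `A` factors linearly through the Hermite data. -/
theorem exists_linearMap_aeval_eq_jet {n : ℕ} (A : Matrix (Fin n) (Fin n) ℂ) :
    ∃ G : (JetIndex A → ℂ) →ₗ[ℂ] Matrix (Fin n) (Fin n) ℂ, ∀ P : Polynomial ℂ,
      Polynomial.aeval A P = G fun i => (Polynomial.derivative^[(i.2 : ℕ)] P).eval (i.1 : ℂ) := by
  let J : Polynomial ℂ →ₗ[ℂ] (JetIndex A → ℂ) :=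
    LinearMap.pi fun i => (Polynomial.leval (i.1 : ℂ)).comp
      ((Polynomial.derivative (R := ℂ)) ^ (i.2 : ℕ))
  have hJ : ∀ P i, J P i = (Polynomial.derivative^[(i.2 : ℕ)] P).eval (i.1 : ℂ) := by
    intro P i
    simp [J, Module.End.pow_apply, Polynomial.leval]
  have hker : LinearMap.ker J ≤ LinearMap.ker (Polynomial.aeval A).toLinearMap := by
    intro P hP
    rw [LinearMap.mem_ker] at hP
    refine aeval_eq_zero_of_hermite_zero A P fun μ j hj => ?_
    have hμ : μ ∈ (minpoly ℂ A).roots.toFinset := by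
      rw [Multiset.mem_toFinset, ← Multiset.count_pos, Polynomial.count_roots]
      omega
    have := congrFun hP ⟨⟨μ, hμ⟩, ⟨j, hj⟩⟩
    rwa [hJ] at this
  -- A left inverse of the injection induced by `J` makes `G` defined on all jets, without proving
  -- that every jet is attained.
  obtain ⟨s, hs⟩ := LinearMap.exists_leftInverse_of_injective
    ((LinearMap.ker J).liftQ J le_rfl) (Submodule.ker_liftQ_eq_bot' _ J rfl)
  refine ⟨((LinearMap.ker J).liftQ (Polynomial.aeval A).toLinearMap hker).comp s, fun P => ?_⟩
  have h1 : (fun i : JetIndex A => (Polynomial.derivative^[(i.2 : ℕ)] P).eval (i.1 : ℂ)) =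
      (LinearMap.ker J).liftQ J le_rfl ((LinearMap.ker J).mkQ P) := by
    funext i
    simp [hJ]
  have h2 : s ((LinearMap.ker J).liftQ J le_rfl ((LinearMap.ker J).mkQ P)) =
      (LinearMap.ker J).mkQ P := LinearMap.congr_fun hs _
  rw [h1, LinearMap.comp_apply, h2]
  simp

theorem primaryMatrixFunction_eq_jet {n : ℕ} (A : Matrix (Fin n) (Fin n) ℂ)
    (G : (JetIndex A → ℂ) →ₗ[ℂ] Matrix (Fin n) (Fin n) ℂ)
    (hG : ∀ P : Polynomial ℂ, Polynomial.aeval A P =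
      G fun i => (Polynomial.derivative^[(i.2 : ℕ)] P).eval (i.1 : ℂ)) (f : ℂ → ℂ) :
    primaryMatrixFunction f A = G fun i => iteratedDeriv i.2 f i.1 := by
  have h := (existsUnique_isHermiteInterpolant f A).choose_spec.1
  rw [primaryMatrixFunction, hG]
  congr 1
  funext i
  exact h.2 _ _ i.2.2

/-- This is the exponential series differentiated j times in μ; the terms with k < j vanish, and the
rest is a shifted exponential series. -/
theorem hasSum_exp_iterate_derivative (s μ : ℂ) (j : ℕ) :
    HasSum (fun k : ℕ => ((k.factorial : ℂ)⁻¹ * s ^ k) *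
      (Polynomial.derivative^[j] (Polynomial.X ^ k : Polynomial ℂ)).eval μ)
      (s ^ j * Complex.exp (s * μ)) := by
  have h0 : ∑ k ∈ Finset.range j, ((k.factorial : ℂ)⁻¹ * s ^ k) *
      (Polynomial.derivative^[j] (Polynomial.X ^ k : Polynomial ℂ)).eval μ = 0 := by
    refine Finset.sum_eq_zero fun k hk => ?_
    rw [Polynomial.iterate_derivative_X_pow_eq_smul,
      Nat.descFactorial_eq_zero_iff_lt.2 (Finset.mem_range.1 hk)]
    simp
  have h1 := (hasSum_nat_add_iff (f := fun k : ℕ => ((k.factorial : ℂ)⁻¹ * s ^ k) *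
      (Polynomial.derivative^[j] (Polynomial.X ^ k : Polynomial ℂ)).eval μ)
      (g := s ^ j * Complex.exp (s * μ)) j)
  rw [h0, add_zero] at h1
  rw [← h1]
  have h2 := (NormedSpace.exp_series_hasSum_exp' (𝕂 := ℂ) (s * μ)).mul_left (s ^ j)
  rw [← Complex.exp_eq_exp_ℂ] at h2
  refine h2.congr_fun fun k => ?_
  have hf : ((k + j).factorial : ℂ) = k.factorial * (k + j).descFactorial j := by
    have := Nat.factorial_mul_descFactorial (Nat.le_add_left j k)
    rw [Nat.add_sub_cancel] at this
    exact_mod_cast this.symm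
  have hd : ((k + j).descFactorial j : ℂ) ≠ 0 := by
    exact_mod_cast (Nat.descFactorial_pos.2 (Nat.le_add_left j k)).ne'
  have hk : (k.factorial : ℂ) ≠ 0 := by exact_mod_cast k.factorial_ne_zero
  rw [Polynomial.iterate_derivative_X_pow_eq_smul, hf]
  simp only [Polynomial.eval_smul, Polynomial.eval_pow, Polynomial.eval_X, Nat.add_sub_cancel,
    smul_eq_mul]
  field_simp
  ring

/-- The exponential of `s A` is the primary matrix function of `z ↦ exp (s z)`. -/
theorem exp_smul_eq_jet {n : ℕ} {E : Type*} [NormedRing E] [NormedAlgebra ℂ E] [CompleteSpace E]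
    (A : Matrix (Fin n) (Fin n) ℂ) (G : (JetIndex A → ℂ) →ₗ[ℂ] Matrix (Fin n) (Fin n) ℂ)
    (hG : ∀ P : Polynomial ℂ, Polynomial.aeval A P =
      G fun i => (Polynomial.derivative^[(i.2 : ℕ)] P).eval (i.1 : ℂ))
    (Ψ : Matrix (Fin n) (Fin n) ℂ →ₐ[ℂ] E) (s : ℂ) :
    NormedSpace.exp (s • Ψ A) = Ψ (G fun i => s ^ (i.2 : ℕ) * Complex.exp (s * i.1)) := by
  let T : (JetIndex A → ℂ) →L[ℂ] E := LinearMap.toContinuousLinearMap (Ψ.toLinearMap.comp G)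
  have h1 : HasSum (fun k : ℕ => fun i : JetIndex A => ((k.factorial : ℂ)⁻¹ * s ^ k) *
      (Polynomial.derivative^[(i.2 : ℕ)] (Polynomial.X ^ k : Polynomial ℂ)).eval (i.1 : ℂ))
      (fun i : JetIndex A => s ^ (i.2 : ℕ) * Complex.exp (s * i.1)) :=
    Pi.hasSum.2 fun i => hasSum_exp_iterate_derivative s i.1 i.2
  have h2 := T.hasSum h1
  refine (NormedSpace.exp_series_hasSum_exp' (𝕂 := ℂ) (s • Ψ A)).unique (h2.congr_fun fun k => ?_)
  have h3 : (fun i : JetIndex A => ((k.factorial : ℂ)⁻¹ * s ^ k) *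
      (Polynomial.derivative^[(i.2 : ℕ)] (Polynomial.X ^ k : Polynomial ℂ)).eval (i.1 : ℂ)) =
      ((k.factorial : ℂ)⁻¹ * s ^ k) • fun i : JetIndex A =>
      (Polynomial.derivative^[(i.2 : ℕ)] (Polynomial.X ^ k : Polynomial ℂ)).eval (i.1 : ℂ) := rfl
  rw [h3, map_smul]
  change _ = _ • Ψ (G _)
  rw [← hG, map_pow, Polynomial.aeval_X, map_pow, smul_pow, smul_smul]

/-! ### Logarithmic moments and derivatives of Γ -/

open MeasureTheory Set Filter Topology Asymptotics

theorem locallyIntegrableOn_log_pow_mul_exp_neg (j : ℕ) :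
    LocallyIntegrableOn (fun t : ℝ => ((Real.log t ^ j * Real.exp (-t) : ℝ) : ℂ)) (Ioi 0) := by
  refine ContinuousOn.locallyIntegrableOn ?_ measurableSet_Ioi
  refine Complex.continuous_ofReal.comp_continuousOn (ContinuousOn.mul ?_ (by fun_prop))
  exact (Real.continuousOn_log.mono fun t ht => (mem_Ioi.1 ht).ne').pow j

theorem isBigO_atTop_log_pow_mul_exp_neg (j : ℕ) (a : ℝ) :
    (fun t : ℝ => ((Real.log t ^ j * Real.exp (-t) : ℝ) : ℂ)) =O[atTop] (· ^ (-a)) := by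
  induction j generalizing a with
  | zero =>
    have := (isLittleO_exp_neg_mul_rpow_atTop one_pos (-a)).isBigO
    simp only [neg_mul, one_mul] at this
    simpa [← Complex.ofReal_exp] using Complex.isBigO_ofReal_left.2 this
  | succ j ih =>
    refine (isBigO_rpow_top_log_smul (lt_add_one a) (ih (a + 1))).congr_left fun t => ?_
    simp [pow_succ']
    ring

theorem isBigO_zero_log_pow_mul_exp_neg (j : ℕ) {b : ℝ} (hb : 0 < b) :
    (fun t : ℝ => ((Real.log t ^ j * Real.exp (-t) : ℝ) : ℂ)) =O[𝓝[>] 0] (· ^ (-b)) := by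
  induction j generalizing b with
  | zero =>
    refine IsBigO.of_bound 1 ?_
    filter_upwards [Ioc_mem_nhdsGT one_pos] with t ht
    have h1 : Real.exp (-t) ≤ 1 := Real.exp_le_one_iff.2 (by linarith [ht.1])
    have h2 : (1 : ℝ) ≤ t ^ (-b) :=
      Real.one_le_rpow_of_pos_of_le_one_of_nonpos ht.1 ht.2 (by linarith)
    rw [Complex.norm_real, Real.norm_of_nonneg (by positivity),
      Real.norm_of_nonneg (by linarith)]
    simpa using h1.trans h2
  | succ j ih =>
    -- Each logarithm costs an arbitrarily small power of t, so half of the exponent is kept for the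
    -- remaining ones.
    refine (isBigO_rpow_zero_log_smul (half_lt_self hb) (ih (half_pos hb))).congr_left fun t => ?_
    simp [pow_succ']
    ring

theorem mellinConvergent_log_pow_mul_exp_neg (j : ℕ) {s : ℂ} (hs : 0 < s.re) :
    MellinConvergent (fun t : ℝ => ((Real.log t ^ j * Real.exp (-t) : ℝ) : ℂ)) s :=
  mellinConvergent_of_isBigO_rpow (locallyIntegrableOn_log_pow_mul_exp_neg j)
    (isBigO_atTop_log_pow_mul_exp_neg j (s.re + 1)) (lt_add_one _)
    (isBigO_zero_log_pow_mul_exp_neg j (half_pos hs)) (half_lt_self hs)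

/-- The derivatives of the Gamma function on the right half plane are the logarithmic moments of
its integral representation. -/
theorem iteratedDeriv_Gamma_eq_mellin (j : ℕ) {s : ℂ} (hs : 0 < s.re) :
    iteratedDeriv j Complex.Gamma s =
      mellin (fun t : ℝ => ((Real.log t ^ j * Real.exp (-t) : ℝ) : ℂ)) s := by
  induction j generalizing s with
  | zero =>
    rw [iteratedDeriv_zero, Complex.Gamma_eq_integral hs, Complex.GammaIntegral_eq_mellin]
    simp
  | succ j ih =>
    have hU : {z : ℂ | 0 < z.re} ∈ 𝓝 s :=
      (isOpen_lt continuous_const Complex.continuous_re).mem_nhds hs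
    rw [iteratedDeriv_succ]
    have : iteratedDeriv j Complex.Gamma =ᶠ[𝓝 s]
        mellin (fun t : ℝ => ((Real.log t ^ j * Real.exp (-t) : ℝ) : ℂ)) := by
      filter_upwards [hU] with z hz using ih hz
    rw [this.deriv_eq, (mellin_hasDerivAt_of_isBigO_rpow (locallyIntegrableOn_log_pow_mul_exp_neg j)
      (isBigO_atTop_log_pow_mul_exp_neg j (s.re + 1)) (lt_add_one _)
      (isBigO_zero_log_pow_mul_exp_neg j (half_pos hs)) (half_lt_self hs)).2.deriv]
    congr 1
    funext t
    simp [pow_succ']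
    ring

theorem integrableOn_rpow_mul_log_mul_exp_neg {x : ℝ} (hx : 0 < x) :
    IntegrableOn (fun t : ℝ => t ^ (x - 1) * (Real.log t * Real.exp (-t))) (Ioi 0) := by
  have h := mellinConvergent_log_pow_mul_exp_neg 1 (s := x) (by simpa using hx)
  refine (IntegrableOn.congr_fun h.re (fun t ht => ?_) measurableSet_Ioi)
  beta_reduce
  rw [pow_one, smul_eq_mul, ← Complex.ofReal_one, ← Complex.ofReal_sub,
    ← Complex.ofReal_cpow (le_of_lt ht), ← Complex.ofReal_mul]
  rfl

theorem deriv_real_Gamma_eq_integral {x : ℝ} (hx : 0 < x) :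
    deriv Real.Gamma x = ∫ t in Ioi (0 : ℝ), t ^ (x - 1) * (Real.log t * Real.exp (-t)) := by
  have hx' : 0 < (x : ℂ).re := by simpa using hx
  have hd : DifferentiableAt ℂ Complex.Gamma x := by
    refine Complex.differentiableAt_Gamma _ fun m hm => ?_
    rw [hm] at hx'
    have : (0 : ℝ) ≤ m := m.cast_nonneg
    simp at hx'
    linarith
  have h1 := hd.hasDerivAt.real_of_complex
  have h2 : deriv Complex.Gamma x =
      ((∫ t in Ioi (0 : ℝ), t ^ (x - 1) * (Real.log t * Real.exp (-t)) : ℝ) : ℂ) := by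
    rw [← iteratedDeriv_one, iteratedDeriv_Gamma_eq_mellin 1 hx', mellin, ← integral_complex_ofReal]
    refine setIntegral_congr_fun measurableSet_Ioi fun t ht => ?_
    rw [pow_one, smul_eq_mul, ← Complex.ofReal_one, ← Complex.ofReal_sub,
      ← Complex.ofReal_cpow (le_of_lt ht), ← Complex.ofReal_mul]
  rw [h2, Complex.ofReal_re] at h1
  exact h1.deriv

/-! ### The integral of t^{b-1} |log t| over (0, 1] -/

theorem hasDerivAt_rpow_mul_log_primitive {b t : ℝ} (hb : 0 < b) (ht : 0 < t) :
    HasDerivAt (fun t : ℝ => t ^ b / b ^ 2 - t ^ b * Real.log t / b)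
      (t ^ (b - 1) * -Real.log t) t := by
  have h1 := Real.hasDerivAt_rpow_const (x := t) (p := b) (Or.inl ht.ne')
  refine ((h1.div_const (b ^ 2)).sub ((h1.mul (Real.hasDerivAt_log ht.ne')).div_const b)).congr_deriv
    ?_
  have : t ^ b = t ^ (b - 1) * t := by
    rw [← Real.rpow_add_one ht.ne', sub_add_cancel]
  rw [this]
  field_simp
  ring

theorem tendsto_rpow_mul_log_primitive {b : ℝ} (hb : 0 < b) :
    Tendsto (fun t : ℝ => t ^ b / b ^ 2 - t ^ b * Real.log t / b) (𝓝[>] 0) (𝓝 0) := by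
  have h1 : Tendsto (fun t : ℝ => t ^ b) (𝓝[>] 0) (𝓝 0) := by
    have := (Real.continuousAt_rpow_const 0 b (Or.inr hb.le)).tendsto
    rw [Real.zero_rpow hb.ne'] at this
    exact this.mono_left nhdsWithin_le_nhds
  have h2 := tendsto_log_mul_rpow_nhdsGT_zero hb
  have := (h1.div_const (b ^ 2)).sub (h2.div_const b)
  simp only [zero_div, sub_zero] at this
  refine this.congr fun t => by ring

theorem integrableOn_rpow_mul_neg_log {b : ℝ} (hb : 0 < b) :
    IntegrableOn (fun t : ℝ => t ^ (b - 1) * -Real.log t) (Ioc 0 1) ∧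
    ∫ t in Ioc (0 : ℝ) 1, t ^ (b - 1) * -Real.log t = 1 / b ^ 2 := by
  have hcont : ContinuousOn (fun t : ℝ => t ^ b / b ^ 2 - t ^ b * Real.log t / b) (Icc 0 1) := by
    intro t ht
    rcases ht.1.eq_or_lt with rfl | h0
    · refine ContinuousWithinAt.mono (continuousWithinAt_Ioi_iff_Ici.1 ?_) Icc_subset_Ici_self
      rw [ContinuousWithinAt]
      simpa [Real.zero_rpow hb.ne'] using tendsto_rpow_mul_log_primitive hb
    · exact (hasDerivAt_rpow_mul_log_primitive hb h0).continuousAt.continuousWithinAt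
  have hderiv : ∀ t ∈ Ioo (0 : ℝ) 1, HasDerivAt
      (fun t : ℝ => t ^ b / b ^ 2 - t ^ b * Real.log t / b) (t ^ (b - 1) * -Real.log t) t :=
    fun t ht => hasDerivAt_rpow_mul_log_primitive hb ht.1
  have hint := intervalIntegral.integrableOn_deriv_of_nonneg hcont hderiv fun t ht =>
    mul_nonneg (Real.rpow_nonneg ht.1.le _) (neg_nonneg.2 (Real.log_nonpos ht.1.le ht.2.le))
  refine ⟨hint, ?_⟩
  rw [← intervalIntegral.integral_of_le zero_le_one,
    intervalIntegral.integral_eq_sub_of_hasDerivAt_of_le zero_le_one hcont hderiv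
      ((intervalIntegrable_iff_integrableOn_Ioc_of_le zero_le_one).2 hint)]
  simp [Real.zero_rpow hb.ne']

/-! ### Induced p-norms and eigenvalue localization -/

section PNorm

theorem PiLp.norm_le_norm_of_forall_le {ι : Type*} [Fintype ι] {β γ : ι → Type*}
    [∀ i, SeminormedAddCommGroup (β i)] [∀ i, SeminormedAddCommGroup (γ i)]
    (p : ℝ≥0∞) [Fact (1 ≤ p)] (v : PiLp p β) (w : PiLp p γ)
    (h : ∀ i, ‖v i‖ ≤ ‖w i‖) : ‖v‖ ≤ ‖w‖ := by
  rcases p.dichotomy with rfl | hp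
  · rw [PiLp.norm_eq_ciSup, PiLp.norm_eq_ciSup]
    exact ciSup_mono (Set.finite_range _).bddAbove h
  · have hp0 : 0 < p.toReal := by linarith
    rw [PiLp.norm_eq_sum hp0, PiLp.norm_eq_sum hp0]
    gcongr with i
    exact h i

/-- Entrywise |Av| ≤ R|v|, the p-norm is monotone in the moduli of the entries, and |v| has the same
norm as v. -/
theorem matrixPNorm_le_of_norm_le {n : ℕ} (p : ℝ≥0∞) [Fact (1 ≤ p)]
    (A : Matrix (Fin n) (Fin n) ℂ) (R : Matrix (Fin n) (Fin n) ℝ) (h : ∀ i j, ‖A i j‖ ≤ R i j) :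
    matrixPNorm p A ≤ matrixPNorm p (R.map Complex.ofReal) := by
  refine ContinuousLinearMap.opNorm_le_bound _ (norm_nonneg _) fun v => ?_
  let w : PiLp p fun _ : Fin n => ℂ := WithLp.toLp p fun i => (‖v i‖ : ℂ)
  have hw : ‖w‖ ≤ ‖v‖ := PiLp.norm_le_norm_of_forall_le p _ _ fun i => by simp [w]
  refine le_trans ?_ ((ContinuousLinearMap.le_opNorm
    (LinearMap.toContinuousLinearMap (Matrix.toLpLin p p (R.map Complex.ofReal))) w).trans
    (mul_le_mul_of_nonneg_left hw (norm_nonneg _)))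
  refine PiLp.norm_le_norm_of_forall_le p _ _ fun i => ?_
  have hR : ∀ j, 0 ≤ R i j := fun j => (norm_nonneg _).trans (h i j)
  have e1 : (LinearMap.toContinuousLinearMap (Matrix.toLpLin p p A)) v i = ∑ j, A i j * v j := by
    simp [Matrix.mulVec, dotProduct]
  have e2 : (LinearMap.toContinuousLinearMap (Matrix.toLpLin p p (R.map Complex.ofReal))) w i =
      ((∑ j, R i j * ‖v j‖ : ℝ) : ℂ) := by
    simp [Matrix.mulVec, dotProduct, w]
  rw [e1, e2, Complex.norm_real,
    Real.norm_of_nonneg (Finset.sum_nonneg fun j _ => mul_nonneg (hR j) (norm_nonneg _))]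
  refine (norm_sum_le _ _).trans (Finset.sum_le_sum fun j _ => ?_)
  rw [norm_mul]
  exact mul_le_mul_of_nonneg_right (h i j) (norm_nonneg _)

/-- Matrices as operators on `ℂⁿ` with the `p`-norm. -/
noncomputable def matrixToPOperator {n : ℕ} (p : ℝ≥0∞) [Fact (1 ≤ p)] :
    Matrix (Fin n) (Fin n) ℂ ≃ₐ[ℂ]
      ((PiLp p fun _ : Fin n => ℂ) →L[ℂ] (PiLp p fun _ : Fin n => ℂ)) :=
  (Matrix.toLpLinAlgEquiv p).trans (Module.End.toContinuousLinearMap _)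

theorem matrixPNorm_eq_norm {n : ℕ} (p : ℝ≥0∞) [Fact (1 ≤ p)] (A : Matrix (Fin n) (Fin n) ℂ) :
    matrixPNorm p A = ‖matrixToPOperator p A‖ := rfl

theorem matrixPNorm_eq_zero_iff {n : ℕ} (p : ℝ≥0∞) [Fact (1 ≤ p)] (A : Matrix (Fin n) (Fin n) ℂ) :
    matrixPNorm p A = 0 ↔ A = 0 := by
  rw [matrixPNorm_eq_norm, norm_eq_zero, map_eq_zero_iff _ (matrixToPOperator p).injective]

/-- The eigenvalues of `λ I + Q` lie within `‖Q‖_p` of `λ`. -/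
theorem norm_sub_le_of_isRoot_minpoly {n : ℕ} (p : ℝ≥0∞) [Fact (1 ≤ p)] (lam μ : ℂ)
    (Q : Matrix (Fin n) (Fin n) ℂ)
    (hμ : (minpoly ℂ (lam • (1 : Matrix (Fin n) (Fin n) ℂ) + Q)).IsRoot μ) :
    ‖μ - lam‖ ≤ matrixPNorm p Q := by
  rw [← minpoly.algEquiv_eq (Matrix.toLpLinAlgEquiv p)] at hμ
  obtain ⟨v, hv⟩ := (Module.End.hasEigenvalue_of_isRoot hμ).exists_hasEigenvector
  have h1 : matrixToPOperator p Q v = (μ - lam) • v := by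
    have h2 := hv.apply_eq_smul
    rw [map_add, map_smul, map_one, LinearMap.add_apply, LinearMap.smul_apply] at h2
    rw [sub_smul, ← h2]
    simp [matrixToPOperator, Module.End.toContinuousLinearMap]
  have h3 := (matrixToPOperator p Q).le_opNorm v
  rw [h1, norm_smul] at h3
  exact le_of_mul_le_mul_right h3 (norm_pos_iff.2 hv.2)

end PNorm

/-! ### Euler's integral for matrices -/

section Integral

variable {E : Type*} [NormedRing E] [NormedAlgebra ℂ E] [CompleteSpace E]

/-- The Gamma function of a matrix with spectrum in the right half plane is given by Euler's
integral `∫ e^{-t} t^{A - 1} dt`. -/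
theorem matrixGamma_eq_integral {n : ℕ} (A : Matrix (Fin n) (Fin n) ℂ)
    (hA : ∀ μ : ℂ, (minpoly ℂ A).IsRoot μ → 0 < μ.re) (Ψ : Matrix (Fin n) (Fin n) ℂ →ₐ[ℂ] E) :
    IntegrableOn (fun t : ℝ => ((t⁻¹ * Real.exp (-t) : ℝ) : ℂ) •
      NormedSpace.exp ((Real.log t : ℂ) • Ψ A)) (Ioi 0) ∧
    Ψ (matrixGamma A) = ∫ t in Ioi (0 : ℝ), ((t⁻¹ * Real.exp (-t) : ℝ) : ℂ) •
      NormedSpace.exp ((Real.log t : ℂ) • Ψ A) := by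
  obtain ⟨G, hG⟩ := exists_linearMap_aeval_eq_jet A
  let T : (JetIndex A → ℂ) →L[ℂ] E := LinearMap.toContinuousLinearMap (Ψ.toLinearMap.comp G)
  have hre : ∀ i : JetIndex A, 0 < (i.1 : ℂ).re := fun i =>
    hA _ (Polynomial.isRoot_of_mem_roots (Multiset.mem_toFinset.1 i.1.2))
  let f : ℝ → JetIndex A → ℂ := fun t i => (t : ℂ) ^ ((i.1 : ℂ) - 1) •
    ((Real.log t ^ (i.2 : ℕ) * Real.exp (-t) : ℝ) : ℂ)
  have hf : ∀ i, Integrable (fun t => f t i) (volume.restrict (Ioi 0)) := fun i =>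
    mellinConvergent_log_pow_mul_exp_neg i.2 (hre i)
  have hT : EqOn (fun t => T (f t)) (fun t : ℝ => ((t⁻¹ * Real.exp (-t) : ℝ) : ℂ) •
      NormedSpace.exp ((Real.log t : ℂ) • Ψ A)) (Ioi 0) := by
    intro t ht
    have ht0 : (t : ℂ) ≠ 0 := Complex.ofReal_ne_zero.2 (ne_of_gt ht)
    beta_reduce
    rw [exp_smul_eq_jet A G hG Ψ]
    change _ = _ • T _
    rw [← map_smul]
    congr 1
    funext i
    rw [Pi.smul_apply]
    simp only [f]
    rw [Complex.cpow_sub _ _ ht0, Complex.cpow_def_of_ne_zero ht0, Complex.cpow_one,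
      ← Complex.ofReal_log (le_of_lt ht)]
    push_cast
    simp only [smul_eq_mul]
    field_simp
  refine ⟨(T.integrable_comp (Integrable.of_eval hf)).congr
    ((ae_restrict_mem measurableSet_Ioi).mono fun t ht => hT ht), ?_⟩
  rw [← setIntegral_congr_fun measurableSet_Ioi hT, T.integral_comp_comm (Integrable.of_eval hf),
    matrixGamma, primaryMatrixFunction_eq_jet A G hG]
  change T _ = T _
  congr 1
  funext i
  rw [eval_integral hf, iteratedDeriv_Gamma_eq_mellin _ (hre i)]
  rfl

theorem norm_exp_sub_one_le_exp_norm_sub_one (X : E) :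
    ‖NormedSpace.exp X - 1‖ ≤ Real.exp ‖X‖ - 1 := by
  have h1 := (hasSum_nat_add_iff' 1).2 (NormedSpace.exp_series_hasSum_exp' (𝕂 := ℂ) X)
  have h2 := (hasSum_nat_add_iff' 1).2 (NormedSpace.exp_series_hasSum_exp' (𝕂 := ℝ) ‖X‖)
  rw [← Real.exp_eq_exp_ℝ] at h2
  simp only [Finset.sum_range_one, Nat.factorial_zero, Nat.cast_one, inv_one, pow_zero,
    one_smul] at h1 h2
  rw [← h1.tsum_eq]
  refine tsum_of_norm_bounded h2 fun k => ?_
  rw [norm_smul, norm_inv, Complex.norm_natCast, smul_eq_mul]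
  gcongr
  -- Only positive powers remain, so ‖1‖ = 1 is not needed; it fails for 0 × 0 matrices.
  exact norm_pow_le' X k.succ_pos

theorem exp_smul_smul_one_add (s lam : ℂ) (X : E) :
    NormedSpace.exp (s • (lam • (1 : E) + X)) =
      Complex.exp (s * lam) • NormedSpace.exp (s • X) := by
  let : NormedAlgebra ℚ E := NormedAlgebra.restrictScalars ℚ ℂ E
  have h1 : s • (lam • (1 : E) + X) = algebraMap ℂ E (s * lam) + s • X := by
    rw [smul_add, smul_smul, Algebra.algebraMap_eq_smul_one]
  rw [h1, NormedSpace.exp_add_of_commute (Algebra.commutes _ _),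
    ← NormedSpace.algebraMap_exp_comm (𝕂 := ℂ), ← Complex.exp_eq_exp_ℂ,
    Algebra.smul_def (Complex.exp (s * lam))]

/-- The integrand of `Γ(λ I + Q) - Γ(λ I)` is bounded by the scalar one. -/
theorem norm_gamma_integrand_sub_le {t : ℝ} (ht : 0 < t) (lam : ℂ) (X : E) {ρ : ℝ}
    (hX : ‖X‖ ≤ ρ) :
    ‖((t⁻¹ * Real.exp (-t) : ℝ) : ℂ) • NormedSpace.exp ((Real.log t : ℂ) • (lam • (1 : E) + X)) -
      ((t⁻¹ * Real.exp (-t) : ℝ) : ℂ) • NormedSpace.exp ((Real.log t : ℂ) • (lam • (1 : E)))‖ ≤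
    Real.exp (-t) * t ^ (lam.re - 1) * (Real.exp (|Real.log t| * ρ) - 1) := by
  have h0 := exp_smul_smul_one_add (Real.log t : ℂ) lam (0 : E)
  rw [add_zero, smul_zero, NormedSpace.exp_zero] at h0
  rw [h0, exp_smul_smul_one_add, ← smul_sub, ← smul_sub, norm_smul, norm_smul, ← mul_assoc]
  have h1 : ‖((t⁻¹ * Real.exp (-t) : ℝ) : ℂ)‖ * ‖Complex.exp (Real.log t * lam)‖ =
      Real.exp (-t) * t ^ (lam.re - 1) := by
    rw [Complex.norm_real, Real.norm_of_nonneg (by positivity), Complex.norm_exp,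
      Complex.re_ofReal_mul, Real.rpow_sub_one ht.ne', Real.rpow_def_of_pos ht]
    field_simp
  rw [h1]
  refine mul_le_mul_of_nonneg_left ((norm_exp_sub_one_le_exp_norm_sub_one _).trans ?_)
    (by positivity)
  rw [norm_smul, Complex.norm_real, Real.norm_eq_abs]
  gcongr

end Integral

/-! ### The scalar majorant and its integral -/

section Bound

/-- The weight on `(0, 1]` whose integral bounds the correction terms `ω`. -/
noncomputable def logWeight (α t : ℝ) : ℝ :=
  t ^ (α - 1) * -Real.log t - t ^ (α + 1 - 1) * -Real.log t +
    1 / 2 * (t ^ (α + 2 - 1) * -Real.log t)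

theorem integrableOn_logWeight {α : ℝ} (hα : 0 < α) : IntegrableOn (logWeight α) (Ioc 0 1) :=
  ((integrableOn_rpow_mul_neg_log hα).1.sub (integrableOn_rpow_mul_neg_log (by linarith)).1).add
    ((integrableOn_rpow_mul_neg_log (by linarith)).1.const_mul _)

theorem integral_logWeight_lt_omegaBound {α : ℝ} (hα : 0 < α) :
    ∫ t in Ioc (0 : ℝ) 1, logWeight α t < omegaBound α := by
  obtain ⟨h0, e0⟩ := integrableOn_rpow_mul_neg_log hα
  obtain ⟨h1, e1⟩ := integrableOn_rpow_mul_neg_log (b := α + 1) (by linarith)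
  obtain ⟨h2, e2⟩ := integrableOn_rpow_mul_neg_log (b := α + 2) (by linarith)
  have : ∫ t in Ioc (0 : ℝ) 1, logWeight α t =
      1 / α ^ 2 - 1 / (α + 1) ^ 2 + 1 / 2 * (1 / (α + 2) ^ 2) := by
    unfold logWeight
    rw [← e0, ← e1, ← e2, ← integral_sub h0 h1, ← integral_const_mul]
    exact integral_add (h0.sub h1) (h2.const_mul _)
  rw [this, omegaBound]
  have hc : (1 : ℝ) / 2 < Real.cosh 1 - 1 := by
    rw [Real.cosh_eq]
    linarith [Real.exp_one_gt_d9, Real.exp_neg_one_gt_d9]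
  have h3 : 1 / α ^ 2 - 1 / (α + 1) ^ 2 = (2 * α + 1) / (α ^ 2 * (α + 1) ^ 2) := by
    field_simp
    ring
  rw [h3, mul_one_div]
  gcongr

theorem exp_neg_le_one_sub_add_sq_div_two {t : ℝ} (ht : 0 ≤ t) :
    Real.exp (-t) ≤ 1 - t + t ^ 2 / 2 := by
  have h1 := Real.quadratic_le_exp_of_nonneg ht
  have h2 : Real.exp (-t) * Real.exp t = 1 := by rw [← Real.exp_add]; simp
  have h3 : Real.exp (-t) * (1 + t + t ^ 2 / 2) ≤ 1 :=
    (mul_le_mul_of_nonneg_left h1 (Real.exp_pos _).le).trans_eq h2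
  have h4 : 0 < 1 + t + t ^ 2 / 2 := by positivity
  refine le_of_mul_le_mul_right (h3.trans ?_) h4
  -- (1 - t + t²/2)(1 + t + t²/2) = 1 + t⁴/4.
  nlinarith [sq_nonneg (t ^ 2)]

theorem exp_neg_mul_rpow_mul_neg_log_le_logWeight {α t : ℝ} (ht : t ∈ Ioc (0 : ℝ) 1) :
    Real.exp (-t) * (t ^ (α - 1) * -Real.log t) ≤ logWeight α t := by
  have h1 := exp_neg_le_one_sub_add_sq_div_two ht.1.le
  have h2 : logWeight α t = (1 - t + t ^ 2 / 2) * (t ^ (α - 1) * -Real.log t) := by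
    have e1 : t ^ (α + 1 - 1) = t ^ (α - 1) * t := by
      rw [← Real.rpow_add_one ht.1.ne']; ring_nf
    have e2 : t ^ (α + 2 - 1) = t ^ (α - 1) * t ^ 2 := by
      rw [← Real.rpow_add_natCast ht.1.ne']; push_cast; ring_nf
    rw [logWeight, e1, e2]
    ring
  rw [h2]
  exact mul_le_mul_of_nonneg_right h1 (mul_nonneg (Real.rpow_nonneg ht.1.le _)
    (neg_nonneg.2 (Real.log_nonpos ht.1.le ht.2)))

/-- The majorant of the scalar integrand. -/
theorem exp_neg_mul_rpow_mul_exp_sub_one_le {x ρ t : ℝ} (hρ : 0 ≤ ρ) (ht : 0 < t) :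
    Real.exp (-t) * t ^ (x - 1) * (Real.exp (|Real.log t| * ρ) - 1) ≤
      ρ * (t ^ (x + ρ - 1) * (Real.log t * Real.exp (-t)) +
        (Ioc (0 : ℝ) 1).indicator (fun t => logWeight (x + ρ) t + logWeight (x - ρ) t) t) := by
  -- Multiply 1 - y ≤ e^{-y} by e^y.
  have hy : ∀ y : ℝ, Real.exp y - 1 ≤ y * Real.exp y := fun y => by
    have h1 := Real.add_one_le_exp (-y)
    have h2 : Real.exp (-y) * Real.exp y = 1 := by rw [← Real.exp_add]; simp
    nlinarith [Real.exp_pos y]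
  have h1 := mul_le_mul_of_nonneg_left (hy (|Real.log t| * ρ))
    (by positivity : 0 ≤ Real.exp (-t) * t ^ (x - 1))
  refine h1.trans ?_
  rcases le_or_gt t 1 with h | h
  · have hm : t ∈ Ioc (0 : ℝ) 1 := ⟨ht, h⟩
    rw [indicator_of_mem hm, abs_of_nonpos (Real.log_nonpos ht.le h)]
    have e1 : Real.exp (-Real.log t * ρ) = t ^ (-ρ) := by
      rw [Real.rpow_def_of_pos ht]; ring_nf
    have e2 : t ^ (x - ρ - 1) = t ^ (x - 1) * t ^ (-ρ) := by
      rw [← Real.rpow_add ht]; ring_nf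
    have h2 := exp_neg_mul_rpow_mul_neg_log_le_logWeight (α := x + ρ) hm
    have h3 := exp_neg_mul_rpow_mul_neg_log_le_logWeight (α := x - ρ) hm
    rw [e2] at h3
    rw [e1]
    -- `h3` bounds the left side by the weight at x-ρ, and `h2` says that the weight at x+ρ
    -- outweighs the nonpositive integrand of Γ'.
    nlinarith
  · have hm : t ∉ Ioc (0 : ℝ) 1 := fun hm => hm.2.not_gt h
    rw [indicator_of_notMem hm, abs_of_nonneg (Real.log_nonneg h.le)]
    have e1 : Real.exp (Real.log t * ρ) = t ^ ρ := (Real.rpow_def_of_pos ht _).symm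
    have e2 : t ^ (x + ρ - 1) = t ^ (x - 1) * t ^ ρ := by
      rw [← Real.rpow_add ht]; ring_nf
    rw [e1, e2]
    apply le_of_eq
    ring

theorem integrableOn_gamma_majorant {x ρ : ℝ} (hρ : 0 ≤ ρ) (h : 0 < x - ρ) :
    IntegrableOn (fun t : ℝ => ρ * (t ^ (x + ρ - 1) * (Real.log t * Real.exp (-t)) +
      (Ioc (0 : ℝ) 1).indicator (fun t => logWeight (x + ρ) t + logWeight (x - ρ) t) t))
      (Ioi 0) := by
  refine ((integrableOn_rpow_mul_log_mul_exp_neg (by linarith)).add ?_).const_mul ρ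
  exact (((integrableOn_logWeight (by linarith)).add (integrableOn_logWeight
    h)).integrable_indicator measurableSet_Ioc).integrableOn

theorem integral_gamma_majorant_lt {x ρ : ℝ} (hρ : 0 < ρ) (h : 0 < x - ρ) :
    ∫ t in Ioi (0 : ℝ), ρ * (t ^ (x + ρ - 1) * (Real.log t * Real.exp (-t)) +
      (Ioc (0 : ℝ) 1).indicator (fun t => logWeight (x + ρ) t + logWeight (x - ρ) t) t) <
      deltaBound x ρ := by
  have hx : 0 < x + ρ := by linarith
  have i1 := integrableOn_logWeight hx
  have i2 := integrableOn_logWeight h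
  have i3 : IntegrableOn ((Ioc (0 : ℝ) 1).indicator fun t =>
      logWeight (x + ρ) t + logWeight (x - ρ) t) (Ioi 0) :=
    ((i1.add i2).integrable_indicator measurableSet_Ioc).integrableOn
  rw [integral_const_mul, integral_add (integrableOn_rpow_mul_log_mul_exp_neg hx) i3,
    setIntegral_indicator measurableSet_Ioc, inter_eq_right.2 Ioc_subset_Ioi_self,
    integral_add i1 i2, ← deriv_real_Gamma_eq_integral hx, deltaBound]
  have := integral_logWeight_lt_omegaBound hx
  have := integral_logWeight_lt_omegaBound h
  exact mul_lt_mul_of_pos_left (by linarith) hρ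

end Bound

/-! ### The perturbation bound -/

theorem matrixPNorm_matrixGamma_sub_lt {n : ℕ} (p : ℝ≥0∞) [Fact (1 ≤ p)] (lam : ℂ)
    (Q : Matrix (Fin n) (Fin n) ℂ) {ρ : ℝ} (hQ : matrixPNorm p Q ≤ ρ) (hρ : 0 < ρ)
    (hpos : 0 < lam.re - ρ) :
    matrixPNorm p (matrixGamma (lam • (1 : Matrix (Fin n) (Fin n) ℂ) + Q)
      - matrixGamma (lam • (1 : Matrix (Fin n) (Fin n) ℂ))) < deltaBound lam.re ρ := by
  have hA : ∀ Q : Matrix (Fin n) (Fin n) ℂ, matrixPNorm p Q ≤ ρ → ∀ μ : ℂ,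
      (minpoly ℂ (lam • (1 : Matrix (Fin n) (Fin n) ℂ) + Q)).IsRoot μ → 0 < μ.re := by
    intro Q hQ μ hμ
    have h1 := (norm_sub_le_of_isRoot_minpoly p lam μ Q hμ).trans hQ
    have h2 := (abs_le.1 ((Complex.abs_re_le_norm _).trans h1)).1
    rw [Complex.sub_re] at h2
    linarith
  have h0 := hA 0 (by rw [(matrixPNorm_eq_zero_iff p 0).2 rfl]; exact hρ.le)
  rw [add_zero] at h0
  obtain ⟨i1, e1⟩ := matrixGamma_eq_integral _ (hA Q hQ) (matrixToPOperator p).toAlgHom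
  obtain ⟨i0, e0⟩ := matrixGamma_eq_integral _ h0 (matrixToPOperator p).toAlgHom
  rw [matrixPNorm_eq_norm]
  change ‖(matrixToPOperator p).toAlgHom _‖ < _
  rw [map_sub, e1, e0, ← integral_sub i1 i0]
  refine (norm_integral_le_of_norm_le (integrableOn_gamma_majorant hρ.le hpos)
    ((ae_restrict_mem measurableSet_Ioi).mono fun t ht => ?_)).trans_lt
    (integral_gamma_majorant_lt hρ hpos)
  simp only [map_add, map_smul, map_one]
  exact (norm_gamma_integrand_sub_le ht lam _ hQ).trans
    (exp_neg_mul_rpow_mul_exp_sub_one_le hρ.le ht)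

theorem theorem4p2 (n : ℕ) (p : ℕ∞) [Fact (1 ≤ (p : ℝ≥0∞))] (lam : ℂ)
    (Q : Matrix (Fin n) (Fin n) ℂ) (R : Matrix (Fin n) (Fin n) ℝ)
    (hQR : ∀ i j, ‖Q i j‖ ≤ R i j)
    (hpos : 0 < lam.re - matrixPNorm p (R.map Complex.ofReal)) :
    matrixPNorm p (matrixGamma (lam • (1 : Matrix (Fin n) (Fin n) ℂ) + Q)
          - matrixGamma (lam • (1 : Matrix (Fin n) (Fin n) ℂ)))
        ≤ deltaBound lam.re (matrixPNorm p (R.map Complex.ofReal)) ∧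
      (R ≠ 0 →
        matrixPNorm p (matrixGamma (lam • (1 : Matrix (Fin n) (Fin n) ℂ) + Q)
            - matrixGamma (lam • (1 : Matrix (Fin n) (Fin n) ℂ)))
          < deltaBound lam.re (matrixPNorm p (R.map Complex.ofReal))) := by
  have hQ := matrixPNorm_le_of_norm_le (p : ℝ≥0∞) Q R hQR
  have hlt : R ≠ 0 → 0 < matrixPNorm (p : ℝ≥0∞) (R.map Complex.ofReal) := by
    intro hR
    refine lt_of_le_of_ne (norm_nonneg _) fun h => hR ?_
    have h0 := (matrixPNorm_eq_zero_iff (p : ℝ≥0∞) _).1 h.symm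
    ext i j
    simpa using congrFun (congrFun h0 i) j
  refine ⟨?_, fun hR => matrixPNorm_matrixGamma_sub_lt _ lam Q hQ (hlt hR) hpos⟩
  -- The strict bound needs ρ > 0; for R = 0 both sides vanish.
  by_cases hR : R = 0
  · have hQ0 : Q = 0 := by
      ext i j
      simpa [hR] using hQR i j
    have h0 : matrixPNorm (p : ℝ≥0∞) (R.map Complex.ofReal) = 0 :=
      (matrixPNorm_eq_zero_iff _ _).2 (by simp [hR])
    rw [hQ0, add_zero, sub_self, h0, (matrixPNorm_eq_zero_iff _ _).2 rfl, deltaBound, zero_mul]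
  · exact (matrixPNorm_matrixGamma_sub_lt _ lam Q hQ (hlt hR) hpos).le
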